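/- There is a universal constant $C>0$ with the following property. Let $n,p,m$ be the dimensions, let $X\in\mathbb R^{n\times p}$ and $B^*\in\mathbb R^{p\times m}$ be fixed matrices, let $Y$ be a random matrix in $\mathbb R^{n\times m}$, and let $l_0(\eta;Y)$ be a real-valued loss that is differentiable in $\eta\in\mathbb R^{n\times m}$. Write $\langle A,B\rangle=\sum_{i,j}A_{ij}B_{ij}$, let $\|\cdot\|_F$ be the Frobenius norm, and let $\|B\|_{2,\mathcal C}$ be the number of distinct rows of $B$. Put $\mathbf D_2(A,B)=\|A-B\|_F^2/2$ and, for a differentiable $\psi$, $$\mathbf\Delta_\psi(\alpha,\beta)=\psi(\alpha)-\psi(\beta)-\langle\nabla\psi(\beta),\alpha-\beta\rangle,\qquad \bar{\mathbf\Delta}_\psi(\alpha,\beta)=\tfrac12\{\mathbf\Delta_\psi(\alpha,\beta)+\mathbf\Delta_\psi(\beta,\alpha)\}.$$ Assume that the effective noise $E=-\nabla l_0(XB^*;Y)$ has mean zero and is sub-Gaussian with scale bounded by $\sigma\ge 0$, i.e. $\|\langle E,A\rangle\|_{\psi_2}\le\sigma\|A\|_F$ for every $A\in\mathbb R^{n\times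 m}$, where $\|\xi\|_{\psi_2}=\inf\{t>0:\mathbb E\exp[(\xi/t)^2]\le 2\}$. Let $q,r$ be integers with $r\ge\operatorname{rank}(B^*)$ and $\|B^*\|_{2,\mathcal C}\le q\le p$, let $\mathcal S=\{B\in\mathbb R^{p\times m}:\operatorname{rank}(B)\le r,\ \|B\|_{2,\mathcal C}\le q\}$, and define $P_o(q,r)=\{q\wedge\operatorname{rank}(X)+m\}r+(p-q)\log q$ (with $0\log 0=0$). For $\rho>0$ let $$G_\rho(B;B^-)=l_0(XB;Y)-\mathbf\Delta_{l_0(\cdot;Y)}(XB,XB^-)+\rho\,\mathbf D_2(B,B^-),$$ and let $\hat B$ be any (random) fixed point, that is, almost surely $\hat B\in\operatorname{arg\,min}_{B\in\mathcal S}G_\rho(B;\hat B)$. Assume that for some $\delta>0$ and $K\ge 0$, almost surely, $$\rho\,\mathbf D_2(B_1,B_2)\le 2\bar{\mathbf\Delta}_{l_0(\cdot;Y)}(XB_1,XB_2)-\delta\,\mathbf D_2(XB_1,XB_2)+K\sigma^2P_o(q,r)\qquad\text{for all }B_1,B_2\in\mathcal S.$$ Then $\|X\hat B-XB^*\|_F^2$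 is integrable and $$\mathbb E\|X\hat B-XB^*\|_F^2\le C\,\frac{(K\delta)\vee 1}{\delta^2}\,\bigl\{\sigma^2(q\wedge\operatorname{rank}(X)+m)r+\sigma^2(p-q)\log q+\sigma^2\bigr\}.$$ -/

import Mathlib

open MeasureTheory
open scoped ENNReal Matrix.Norms.Frobenius

noncomputable section

/-- Number of distinct rows `‖B‖_{2,𝒞}` of a matrix. -/
def numDistinctRows {p m : ℕ} (B : Matrix (Fin p) (Fin m) ℝ) : ℕ :=
  (Set.range fun i : Fin p => B i).ncard

/-- Inner product `⟨A, B⟩ = ∑ᵢⱼ Aᵢⱼ Bᵢⱼ` of two real matrices. The associated norm is the Frobenius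
norm, which is the meaning of `‖A‖` for a matrix `A` throughout. -/
def frobInner {n m : ℕ} (A B : Matrix (Fin n) (Fin m) ℝ) : ℝ :=
  ∑ i, ∑ j, A i j * B i j

/-- Gradient of a function of a matrix: the matrix of its partial derivatives. -/
def matGrad {n m : ℕ} (ψ : Matrix (Fin n) (Fin m) ℝ → ℝ) (β : Matrix (Fin n) (Fin m) ℝ) :
    Matrix (Fin n) (Fin m) ℝ :=
  Matrix.of fun i j => fderiv ℝ ψ β (Matrix.single i j 1)

/-- Generalized Bregman function
`Δ_ψ(α, β) = ψ(α) - ψ(β) - ⟨∇ψ(β), α - β⟩`. -/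
def genBregman {n m : ℕ} (ψ : Matrix (Fin n) (Fin m) ℝ → ℝ) (α β : Matrix (Fin n) (Fin m) ℝ) : ℝ :=
  ψ α - ψ β - frobInner (matGrad ψ β) (α - β)

/-- Symmetrized generalized Bregman function. -/
def symBregman {n m : ℕ} (ψ : Matrix (Fin n) (Fin m) ℝ → ℝ) (α β : Matrix (Fin n) (Fin m) ℝ) : ℝ :=
  (genBregman ψ α β + genBregman ψ β α) / 2

/-- `D₂(A, B) = ‖A - B‖_F² / 2`. -/
def D₂ {n m : ℕ} (A B : Matrix (Fin n) (Fin m) ℝ) : ℝ :=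
  ‖A - B‖ ^ 2 / 2

/-- The constraint set: rank at most `r` and at most `q` distinct rows. -/
def crlClass (p m q r : ℕ) : Set (Matrix (Fin p) (Fin m) ℝ) :=
  {B | B.rank ≤ r ∧ numDistinctRows B ≤ q}

/-- Linearized surrogate
`G_ρ(B; B⁻) = l(XB) - Δ_l(XB, XB⁻) + ρ D₂(B, B⁻)` of a loss `l` (the data being fixed). -/
def surrogate {n p m : ℕ} (l : Matrix (Fin n) (Fin m) ℝ → ℝ) (X : Matrix (Fin n) (Fin p) ℝ)
    (ρ : ℝ) (B Bm : Matrix (Fin p) (Fin m) ℝ) : ℝ :=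
  l (X * B) - genBregman l (X * B) (X * Bm) + ρ * D₂ B Bm

/-- `Bh` is a fixed point: it minimizes `G_ρ(· ; Bh)` over the constraint set. -/
def IsCRLFixedPoint {n p m : ℕ} (l : Matrix (Fin n) (Fin m) ℝ → ℝ) (X : Matrix (Fin n) (Fin p) ℝ)
    (ρ : ℝ) (q r : ℕ) (Bh : Matrix (Fin p) (Fin m) ℝ) : Prop :=
  Bh ∈ crlClass p m q r ∧ ∀ B ∈ crlClass p m q r, surrogate l X ρ Bh Bh ≤ surrogate l X ρ B Bh

/-- Complexity `P_o(q, r) = (q ∧ rank X + m) r + (p - q) log q`. -/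
def Po {n p : ℕ} (m : ℕ) (X : Matrix (Fin n) (Fin p) ℝ) (q r : ℕ) : ℝ :=
  ((min q X.rank : ℕ) + (m : ℝ)) * r + ((p : ℝ) - q) * Real.log q

/-- Restricted regularity condition: for all `B₁, B₂` in the constraint set,
`ρ D₂(B₁, B₂) ≤ (2 Δ̄_l - δ D₂)(XB₁, XB₂) + K σ² P_o(q, r)`. -/
def RestrictedRegularity {n p m : ℕ} (l : Matrix (Fin n) (Fin m) ℝ → ℝ)
    (X : Matrix (Fin n) (Fin p) ℝ) (ρ δ K σ : ℝ) (q r : ℕ) : Prop :=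
  ∀ B₁ ∈ crlClass p m q r, ∀ B₂ ∈ crlClass p m q r,
    ρ * D₂ B₁ B₂ ≤
      2 * symBregman l (X * B₁) (X * B₂) - δ * D₂ (X * B₁) (X * B₂) + K * σ ^ 2 * Po m X q r

/-- Orlicz norm `‖ξ‖_{ψ₂} = inf {t > 0 : E exp((ξ/t)²) ≤ 2}`, equal to `∞` if no such `t` exists. -/
def psi2Norm {Ω : Type*} [MeasurableSpace Ω] (μ : Measure Ω) (ξ : Ω → ℝ) : ℝ≥0∞ :=
  ⨅ (t : ℝ) (_ : 0 < t) (_ : ∫⁻ ω, ENNReal.ofReal (Real.exp ((ξ ω / t) ^ 2)) ∂μ ≤ 2),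
    ENNReal.ofReal t

/-- The random matrix `E` is (after vectorization) a sub-Gaussian random vector with mean zero and
scale bounded by `σ`. -/
structure IsCenteredSubGaussian {Ω : Type*} [MeasurableSpace Ω] (μ : Measure Ω) {n m : ℕ}
    (E : Ω → Matrix (Fin n) (Fin m) ℝ) (σ : ℝ) : Prop where
  aemeasurable : ∀ i j, AEMeasurable (fun ω => E ω i j) μ
  mean_zero : ∀ i j, ∫ ω, E ω i j ∂μ = 0
  psi2_le : ∀ A : Matrix (Fin n) (Fin m) ℝ,
    psi2Norm μ (fun ω => frobInner (E ω) A) ≤ ENNReal.ofReal (σ * ‖A‖)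

/-- Effective noise `E = -∇l₀(XB*; Y)`. -/
def effectiveNoise {Ω : Type*} {n p m : ℕ}
    (l₀ : Matrix (Fin n) (Fin m) ℝ → Matrix (Fin n) (Fin m) ℝ → ℝ)
    (X : Matrix (Fin n) (Fin p) ℝ) (Bstar : Matrix (Fin p) (Fin m) ℝ)
    (Y : Ω → Matrix (Fin n) (Fin m) ℝ) (ω : Ω) : Matrix (Fin n) (Fin m) ℝ :=
  -matGrad (fun η => l₀ η (Y ω)) (X * Bstar)

end

/-! ### The basic inequality for a fixed point -/

/-! Write `E` for the effective noise. The surrogate is a linearization of the loss plus a quadratic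
term, so comparing the fixed point with `B*` and adding the regularity condition cancels both the
proximal term and the gradient at `X B̂`. What remains is `δ/2 ‖X B̂ - X B*‖² ≤ ⟨E, X B̂ - X B*⟩ + K
σ² P_o`.

Since `B̂` depends on `E`, the pairing is bounded uniformly over the constraint set by finitely many
deterministic test matrices (`exists_test_matrices`). The row pattern of `B` puts the columns of `X
B - X B*` in one of at most `q ^ (3 (p - q))` subspaces of dimension at most `2 (q ∧ rank X)`, and
their span has dimension at most `2 r`. In each subspace such a matrix is a product of two factors,
and nets of the two factor balls control the bilinear pairing. The logarithm of the number of test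
matrices is of order `P_o + 1`.

The expected maximal square of that many sub-Gaussian pairings is at most their scale squared times
this logarithm (`IsCenteredSubGaussian.exists_sq_majorant`). Solving the quadratic inequality for
the risk and integrating gives the bound. -/

theorem frobInner_neg_left {n m : ℕ} (A B : Matrix (Fin n) (Fin m) ℝ) :
    frobInner (-A) B = -frobInner A B := by
  simp [frobInner]

theorem frobInner_neg_right {n m : ℕ} (A B : Matrix (Fin n) (Fin m) ℝ) :
    frobInner A (-B) = -frobInner A B := by
  simp [frobInner]

theorem two_mul_symBregman {n m : ℕ} (ψ : Matrix (Fin n) (Fin m) ℝ → ℝ)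
    (α β : Matrix (Fin n) (Fin m) ℝ) :
    2 * symBregman ψ α β =
      frobInner (matGrad ψ α) (α - β) - frobInner (matGrad ψ β) (α - β) := by
  have h : frobInner (matGrad ψ α) (β - α) = -frobInner (matGrad ψ α) (α - β) := by
    rw [← frobInner_neg_right, neg_sub]
  unfold symBregman genBregman
  rw [h]
  ring

/-- Removing the Bregman term leaves the first-order expansion of `l` at `X * Bm`. The differences
are oriented to match the regularity condition. -/
theorem surrogate_eq {n p m : ℕ} (l : Matrix (Fin n) (Fin m) ℝ → ℝ)
    (X : Matrix (Fin n) (Fin p) ℝ) (ρ : ℝ) (B Bm : Matrix (Fin p) (Fin m) ℝ) :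
    surrogate l X ρ B Bm =
      l (X * Bm) - frobInner (matGrad l (X * Bm)) (X * Bm - X * B) + ρ * D₂ Bm B := by
  have h : frobInner (matGrad l (X * Bm)) (X * B - X * Bm)
      = -frobInner (matGrad l (X * Bm)) (X * Bm - X * B) := by
    rw [← frobInner_neg_right, neg_sub]
  unfold surrogate genBregman D₂
  rw [h, norm_sub_rev]
  ring

theorem surrogate_self {n p m : ℕ} (l : Matrix (Fin n) (Fin m) ℝ → ℝ)
    (X : Matrix (Fin n) (Fin p) ℝ) (ρ : ℝ) (B : Matrix (Fin p) (Fin m) ℝ) :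
    surrogate l X ρ B B = l (X * B) := by
  rw [surrogate_eq]
  simp [frobInner, D₂]

/-- Comparing a fixed point with a member `Bs` of the constraint set. -/
theorem IsCRLFixedPoint.basic_inequality {n p m q r : ℕ} {l : Matrix (Fin n) (Fin m) ℝ → ℝ}
    {X : Matrix (Fin n) (Fin p) ℝ} {ρ δ K σ : ℝ} {Bh Bs : Matrix (Fin p) (Fin m) ℝ}
    (hfix : IsCRLFixedPoint l X ρ q r Bh) (hreg : RestrictedRegularity l X ρ δ K σ q r)
    (hBs : Bs ∈ crlClass p m q r) :
    δ / 2 * ‖X * Bh - X * Bs‖ ^ 2 ≤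
      frobInner (-matGrad l (X * Bs)) (X * Bh - X * Bs) + K * σ ^ 2 * Po m X q r := by
  have h₁ := hfix.2 Bs hBs
  have h₂ := hreg Bh hfix.1 Bs hBs
  rw [surrogate_self, surrogate_eq] at h₁
  rw [two_mul_symBregman] at h₂
  rw [frobInner_neg_left]
  have h₃ : δ * D₂ (X * Bh) (X * Bs) = δ / 2 * ‖X * Bh - X * Bs‖ ^ 2 := by
    unfold D₂; ring
  -- Both `ρ * D₂ Bh Bs` and the gradient at `X * Bh` cancel on adding `h₁` and `h₂`.
  linarith

/-! ### Nets of unit balls -/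

section Nets

variable {F : Type*} [NormedAddCommGroup F] [NormedSpace ℝ F]

/-- `s` is a subset of the unit ball that approximates every point of it up to `1 / 2`. -/
def IsHalfNet (s : Finset F) : Prop :=
  (∀ y ∈ s, ‖y‖ ≤ 1) ∧ ∀ x : F, ‖x‖ ≤ 1 → ∃ y ∈ s, ‖x - y‖ ≤ 1 / 2

/-- A maximal 1-separated subset of the ball of radius 2 is a 1-net of that ball, with cardinality
controlled by volume; halving it gives the net. -/
theorem exists_isHalfNet (F : Type*) [NormedAddCommGroup F] [NormedSpace ℝ F]
    [FiniteDimensional ℝ F] :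
    ∃ s : Finset F, IsHalfNet s ∧ s.card ≤ 5 ^ Module.finrank ℝ F := by
  classical
  let P : ℕ → Prop := fun k => ∃ s : Finset F, s.card = k ∧ (∀ c ∈ s, ‖c‖ ≤ 2) ∧
    ∀ c ∈ s, ∀ d ∈ s, c ≠ d → 1 ≤ ‖c - d‖
  have hP0 : P 0 := ⟨∅, by simp⟩
  have hmax : P (Nat.findGreatest P (5 ^ Module.finrank ℝ F)) :=
    Nat.findGreatest_spec (Nat.zero_le _) hP0
  obtain ⟨s, hcard, hs, hsep⟩ := hmax
  have hle := Besicovitch.card_le_of_separated s hs hsep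
  have hcover : ∀ x : F, ‖x‖ ≤ 2 → ∃ y ∈ s, ‖x - y‖ ≤ 1 := by
    intro x hx
    by_contra! hfar
    have hxs : x ∉ s := fun h => by simpa using (hfar x h).trans' zero_lt_one
    have hball : ∀ c ∈ insert x s, ‖c‖ ≤ 2 := by
      intro c hc
      rcases Finset.mem_insert.1 hc with rfl | hc
      exacts [hx, hs c hc]
    have hsep' : ∀ c ∈ insert x s, ∀ d ∈ insert x s, c ≠ d → 1 ≤ ‖c - d‖ := by
      intro c hc d hd hcd
      rcases Finset.mem_insert.1 hc with rfl | hc' <;> rcases Finset.mem_insert.1 hd with rfl | hd'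
      · exact absurd rfl hcd
      · exact (hfar d hd').le
      · rw [norm_sub_rev]; exact (hfar c hc').le
      · exact hsep c hc' d hd' hcd
    have h := Nat.le_findGreatest (P := P)
      (Besicovitch.card_le_of_separated _ hball hsep') ⟨_, rfl, hball, hsep'⟩
    rw [Finset.card_insert_of_notMem hxs, ← hcard] at h
    omega
  refine ⟨s.image fun y => (2⁻¹ : ℝ) • y, ⟨?_, ?_⟩, Finset.card_image_le.trans hle⟩
  · simp only [Finset.mem_image, forall_exists_index, and_imp, forall_apply_eq_imp_iff₂]
    intro y hy
    rw [norm_smul]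
    have := hs y hy
    norm_num
    linarith
  · intro x hx
    obtain ⟨y, hy, hxy⟩ := hcover ((2 : ℝ) • x) (by rw [norm_smul]; norm_num; linarith)
    refine ⟨_, Finset.mem_image_of_mem _ hy, ?_⟩
    have : x - (2⁻¹ : ℝ) • y = (2⁻¹ : ℝ) • ((2 : ℝ) • x - y) := by
      rw [smul_sub, smul_smul]; norm_num
    rw [this, norm_smul]
    norm_num
    linarith

/-- Approximating unit vectors by net points gives `‖φ‖ ≤ M + ‖φ‖ / 2`, hence `‖φ‖ ≤ 2 M`. Testing
`-x` as well makes symmetry of the net unnecessary. -/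
theorem IsHalfNet.apply_le {s : Finset F} (hs : IsHalfNet s) (φ : F →L[ℝ] ℝ) {M : ℝ}
    (hM : ∀ y ∈ s, φ y ≤ M) (x : F) : φ x ≤ 2 * M * ‖x‖ := by
  have hball : ∀ x : F, ‖x‖ ≤ 1 → φ x ≤ M + ‖φ‖ / 2 := by
    intro x hx
    obtain ⟨y, hy, hxy⟩ := hs.2 x hx
    have h₁ : φ (x - y) ≤ ‖φ‖ * (1 / 2) :=
      (le_abs_self _).trans ((φ.le_opNorm _).trans (by gcongr))
    rw [map_sub] at h₁
    linarith [hM y hy]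
  have hnonneg : 0 ≤ M + ‖φ‖ / 2 := by simpa using hball 0 (by simp)
  have hnorm : ‖φ‖ ≤ M + ‖φ‖ / 2 := by
    refine φ.opNorm_le_of_unit_norm hnonneg fun x hx => ?_
    rw [Real.norm_eq_abs, abs_le]
    have := hball (-x) (by rw [norm_neg, hx])
    rw [map_neg] at this
    exact ⟨by linarith, hball x hx.le⟩
  calc φ x ≤ ‖φ‖ * ‖x‖ := (le_abs_self _).trans (φ.le_opNorm _)
    _ ≤ 2 * M * ‖x‖ := by gcongr; linarith

theorem IsHalfNet.bilinear_apply_le {G : Type*} [NormedAddCommGroup G] [NormedSpace ℝ G]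
    [FiniteDimensional ℝ F] [FiniteDimensional ℝ G]
    {s : Finset F} {t : Finset G} (hs : IsHalfNet s) (ht : IsHalfNet t)
    (Φ : F →ₗ[ℝ] G →ₗ[ℝ] ℝ) {M : ℝ} (hM : ∀ a ∈ s, ∀ b ∈ t, Φ a b ≤ M)
    (a : F) (b : G) : Φ a b ≤ 4 * M * ‖a‖ * ‖b‖ := by
  have h₁ : ∀ a ∈ s, Φ a b ≤ 2 * M * ‖b‖ := fun a ha =>
    ht.apply_le (Φ a).toContinuousLinearMap (hM a ha) b
  have h₂ := hs.apply_le (Φ.flip b).toContinuousLinearMap h₁ a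
  calc Φ a b ≤ 2 * (2 * M * ‖b‖) * ‖a‖ := h₂
    _ = 4 * M * ‖a‖ * ‖b‖ := by ring

end Nets

/-! ### Counting row patterns -/

/-- Choosing the representatives costs no more than a power of `q ^ (p - q)`, so no `log p` enters.
If `p ≤ q ^ 2`, count the complement; otherwise `p ≤ 2 (p - q)` and the crude bound `2 ^ p`
suffices. -/
theorem choose_mul_pow_le {p q : ℕ} (hq : 2 ≤ q) (hqp : q ≤ p) :
    p.choose q * q ^ (p - q) ≤ q ^ (3 * (p - q)) := by
  have h : p.choose q ≤ q ^ (2 * (p - q)) := by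
    rcases le_total p (q ^ 2) with hp | hp
    · calc p.choose q = p.choose (p - q) := (Nat.choose_symm hqp).symm
        _ ≤ p ^ (p - q) := Nat.choose_le_pow _ _
        _ ≤ (q ^ 2) ^ (p - q) := Nat.pow_le_pow_left hp _
        _ = q ^ (2 * (p - q)) := (pow_mul _ _ _).symm
    · have h2 : 2 * q ≤ p := by nlinarith
      calc p.choose q ≤ 2 ^ p := Nat.choose_le_two_pow _ _
        _ ≤ q ^ p := Nat.pow_le_pow_left hq _
        _ ≤ q ^ (2 * (p - q)) := Nat.pow_le_pow_right (by omega) (by omega)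
  calc p.choose q * q ^ (p - q) ≤ q ^ (2 * (p - q)) * q ^ (p - q) := by gcongr
    _ = q ^ (3 * (p - q)) := by rw [← pow_add]; congr 1; ring

/-- If at most `q` rows of `B` are distinct, then some `q` of the rows exhaust all of them. -/
theorem exists_row_representatives {p m q : ℕ} (hqp : q ≤ p) (B : Matrix (Fin p) (Fin m) ℝ)
    (hB : numDistinctRows B ≤ q) :
    ∃ J : Finset (Fin p), J.card = q ∧ ∀ i, ∃ j ∈ J, B j = B i := by
  classical
  obtain ⟨S, -, hS⟩ := Set.exists_subset_bijOn Set.univ fun i : Fin p => B i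
  rw [Set.image_univ] at hS
  have hcard : S.toFinset.card ≤ q := by
    rw [← Set.ncard_eq_toFinset_card', ← hS.injOn.ncard_image, hS.image_eq]
    exact hB
  obtain ⟨J, hSJ, hJ⟩ := Finset.exists_superset_card_eq hcard (by simpa using hqp)
  refine ⟨J, hJ, fun i => ?_⟩
  obtain ⟨j, hj, hji⟩ := hS.surjOn ⟨i, rfl⟩
  exact ⟨j, hSJ (by simpa using hj), hji⟩

/-- The vectors that are constant on the fibres of `f`. -/
def fibreConstant {p : ℕ} (f : Fin p → Fin p) : Submodule ℝ (Fin p → ℝ) :=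
  LinearMap.range (LinearMap.funLeft ℝ ℝ f)

theorem finrank_fibreConstant_le {p q : ℕ} (f : Fin p → Fin p) (J : Finset (Fin p))
    (hJ : J.card ≤ q) (hf : ∀ i, f i ∈ J) : Module.finrank ℝ (fibreConstant f) ≤ q := by
  have h : fibreConstant f ≤
      LinearMap.range (LinearMap.funLeft ℝ ℝ (fun i => (⟨f i, hf i⟩ : J))) := by
    rintro _ ⟨v, rfl⟩
    exact ⟨fun j => v j, rfl⟩
  calc Module.finrank ℝ (fibreConstant f) ≤ _ := Submodule.finrank_mono h
    _ ≤ Module.finrank ℝ (J → ℝ) := LinearMap.finrank_range_le _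
    _ ≤ q := by simpa using hJ

/-- The columns of matrices with at most `q` distinct rows lie in one of at most `q ^ (3 (p - q))`
subspaces of dimension at most `q`. -/
theorem exists_column_subspaces {p m q : ℕ} (hqp : q ≤ p) (hq : p ≠ 0 → q ≠ 0) :
    ∃ 𝒰 : Finset (Submodule ℝ (Fin p → ℝ)), 𝒰.card ≤ q ^ (3 * (p - q)) ∧
      (∀ U ∈ 𝒰, Module.finrank ℝ U ≤ q) ∧
      ∀ B : Matrix (Fin p) (Fin m) ℝ, numDistinctRows B ≤ q →
        ∃ U ∈ 𝒰, ∀ j, B.col j ∈ U := by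
  classical
  suffices h : ∃ 𝒥 : Finset (Fin p → Fin p), 𝒥.card ≤ q ^ (3 * (p - q)) ∧
      (∀ f ∈ 𝒥, ∃ J : Finset (Fin p), J.card ≤ q ∧ ∀ i, f i ∈ J) ∧
      ∀ B : Matrix (Fin p) (Fin m) ℝ, numDistinctRows B ≤ q → ∃ f ∈ 𝒥, ∀ i, B (f i) = B i by
    obtain ⟨𝒥, hcard, hrange, hcov⟩ := h
    refine ⟨𝒥.image fibreConstant, Finset.card_image_le.trans hcard, ?_, ?_⟩
    · simp only [Finset.mem_image, forall_exists_index, and_imp, forall_apply_eq_imp_iff₂]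
      intro f hf
      obtain ⟨J, hJ, hfJ⟩ := hrange f hf
      exact finrank_fibreConstant_le f J hJ hfJ
    · intro B hB
      obtain ⟨f, hf, hfB⟩ := hcov B hB
      refine ⟨_, Finset.mem_image_of_mem _ hf, fun j => ⟨B.col j, ?_⟩⟩
      ext i
      exact congrFun (hfB i) j
  rcases Nat.lt_or_ge q 2 with hq2 | hq2
  · rcases Nat.eq_zero_or_pos p with rfl | hp
    · obtain rfl : q = 0 := by omega
      exact ⟨{id}, by simp, fun f _ => ⟨∅, by simp, fun i => i.elim0⟩,
        fun B _ => ⟨id, by simp, fun i => rfl⟩⟩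
    -- Here only one pattern is allowed, so the representative is fixed to be row `0`; all rows are
    -- equal.
    · obtain rfl : q = 1 := by have := hq hp.ne'; omega
      refine ⟨{fun _ => ⟨0, hp⟩}, by simp, ?_, fun B hB => ⟨_, Finset.mem_singleton_self _, ?_⟩⟩
      · intro f hf
        rw [Finset.mem_singleton] at hf
        exact ⟨{⟨0, hp⟩}, by simp, by simp [hf]⟩
      · intro i
        obtain ⟨J, hJ, hrep⟩ := exists_row_representatives hqp B hB
        obtain ⟨a, rfl⟩ := Finset.card_eq_one.1 hJ
        have hconst : ∀ i, B a = B i := fun i => by simpa using hrep i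
        exact (hconst _).symm.trans (hconst i)
  -- A pattern fixes a `q`-set `J` of representatives pointwise and sends every other index into
  -- `J`, which leaves `q ^ (p - q)` maps for each `J`.
  · refine ⟨(Finset.powersetCard q Finset.univ).biUnion fun J =>
      Fintype.piFinset fun i => if i ∈ J then {i} else J, ?_, ?_, ?_⟩
    · refine (Finset.card_biUnion_le_card_mul _ _ (q ^ (p - q)) fun J hJ => ?_).trans ?_
      · rw [Finset.mem_powersetCard] at hJ
        rw [Fintype.card_piFinset, ← Finset.prod_mul_prod_compl J]
        rw [Finset.prod_eq_one fun i hi => by simp [hi], one_mul]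
        rw [Finset.prod_congr rfl (g := fun _ => q)
          fun i hi => by rw [if_neg (Finset.mem_compl.1 hi), hJ.2]]
        simp [Finset.card_compl, hJ.2]
      · rw [Finset.card_powersetCard, Finset.card_univ, Fintype.card_fin]
        exact choose_mul_pow_le hq2 hqp
    · intro f hf
      simp only [Finset.mem_biUnion, Finset.mem_powersetCard, Fintype.mem_piFinset] at hf
      obtain ⟨J, ⟨-, hJ⟩, hf⟩ := hf
      refine ⟨J, hJ.le, fun i => ?_⟩
      have := hf i
      split_ifs at this with hi
      · rw [Finset.mem_singleton] at this
        rwa [this]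
      · exact this
    · intro B hB
      obtain ⟨J, hJ, hrep⟩ := exists_row_representatives hqp B hB
      choose g hgJ hgB using hrep
      refine ⟨fun i => if i ∈ J then i else g i, ?_, fun i => ?_⟩
      · simp only [Finset.mem_biUnion, Finset.mem_powersetCard, Fintype.mem_piFinset]
        refine ⟨J, ⟨Finset.subset_univ _, hJ⟩, fun i => ?_⟩
        split_ifs with hi
        · exact Finset.mem_singleton_self _
        · exact hgJ i
      · dsimp only
        split_ifs
        exacts [rfl, hgB i]

noncomputable section

/-! ### Low-rank factorizations and test matrices -/

theorem frobenius_norm_sq {n m : ℕ} (A : Matrix (Fin n) (Fin m) ℝ) :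
    ‖A‖ ^ 2 = ∑ j, ‖WithLp.toLp 2 (A.col j)‖ ^ 2 := by
  simp only [EuclideanSpace.norm_sq_eq]
  rw [Matrix.frobenius_norm_def, ← Real.sqrt_eq_rpow, Real.sq_sqrt (by positivity),
    Finset.sum_comm]
  simp

section Factorization

variable {n m k : ℕ} {V : Submodule ℝ (EuclideanSpace ℝ (Fin n))}

/-- The matrix whose columns are the images under `A` of the columns of `B`. -/
def applyColumns (A : EuclideanSpace ℝ (Fin k) →L[ℝ] V) (B : Matrix (Fin k) (Fin m) ℝ) :
    Matrix (Fin n) (Fin m) ℝ :=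
  Matrix.of fun i j => (A (WithLp.toLp 2 (B.col j)) : EuclideanSpace ℝ (Fin n)) i

theorem norm_applyColumns_le (A : EuclideanSpace ℝ (Fin k) →L[ℝ] V)
    (B : Matrix (Fin k) (Fin m) ℝ) : ‖applyColumns A B‖ ≤ ‖A‖ * ‖B‖ := by
  refine le_of_sq_le_sq ?_ (by positivity)
  rw [mul_pow, frobenius_norm_sq, frobenius_norm_sq, Finset.mul_sum]
  refine Finset.sum_le_sum fun j _ => ?_
  rw [← mul_pow]
  exact pow_le_pow_left₀ (norm_nonneg _) (A.le_opNorm _) 2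

/-- The pairing `(A, B) ↦ ⟨E, A B⟩` as a bilinear form. -/
def factorPairing (V : Submodule ℝ (EuclideanSpace ℝ (Fin n))) (k : ℕ)
    (E : Matrix (Fin n) (Fin m) ℝ) :
    (EuclideanSpace ℝ (Fin k) →L[ℝ] V) →ₗ[ℝ] Matrix (Fin k) (Fin m) ℝ →ₗ[ℝ] ℝ :=
  LinearMap.mk₂ ℝ (fun A B => frobInner E (applyColumns A B))
    (fun A A' B => by
      simp [frobInner, applyColumns, mul_add, Finset.sum_add_distrib])
    (fun c A B => by
      simp [frobInner, applyColumns, Finset.mul_sum, mul_left_comm])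
    (fun A B B' => by
      have h : ∀ j, WithLp.toLp 2 ((B + B').col j)
          = WithLp.toLp 2 (B.col j) + WithLp.toLp 2 (B'.col j) := fun j => rfl
      simp [frobInner, applyColumns, mul_add, Finset.sum_add_distrib, h])
    (fun c A B => by
      have h : ∀ j, WithLp.toLp 2 ((c • B).col j) = c • WithLp.toLp 2 (B.col j) := fun j => rfl
      simp [frobInner, applyColumns, Finset.mul_sum, mul_left_comm, h])

/-- A space of dimension at most `k` embeds isometrically into `ℝ ^ k`. -/
theorem exists_linearIsometry_euclideanSpace {W : Type*} [NormedAddCommGroup W]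
    [InnerProductSpace ℝ W] [FiniteDimensional ℝ W] (h : Module.finrank ℝ W ≤ k) :
    Nonempty (W →ₗᵢ[ℝ] EuclideanSpace ℝ (Fin k)) := by
  let b := stdOrthonormalBasis ℝ W
  let b' : Fin (Module.finrank ℝ W) → EuclideanSpace ℝ (Fin k) := fun i =>
    EuclideanSpace.basisFun (Fin k) ℝ (Fin.castLE h i)
  have hb' : Orthonormal ℝ b' :=
    (EuclideanSpace.basisFun (Fin k) ℝ).orthonormal.comp _ (Fin.castLE_injective h)
  exact ⟨(b.toBasis.constr ℝ b').isometryOfOrthonormal (v := b.toBasis)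
    (by simp)
    (by convert hb' using 1; ext1 i; simp)⟩

/-- A matrix of rank at most `k` with columns in `V` factors through `ℝ ^ k`. -/
theorem exists_applyColumns_eq (Z : Matrix (Fin n) (Fin m) ℝ)
    (W : Submodule ℝ (EuclideanSpace ℝ (Fin n))) (hW : Module.finrank ℝ W ≤ k)
    (hZW : ∀ j, WithLp.toLp 2 (Z.col j) ∈ W) (hZV : ∀ j, WithLp.toLp 2 (Z.col j) ∈ V) :
    ∃ (A : EuclideanSpace ℝ (Fin k) →L[ℝ] V) (B : Matrix (Fin k) (Fin m) ℝ),
      ‖A‖ ≤ 1 ∧ ‖B‖ = ‖Z‖ ∧ applyColumns A B = Z := by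
  obtain ⟨L⟩ := exists_linearIsometry_euclideanSpace (k := k) (W := ↥(V ⊓ W))
    ((Submodule.finrank_mono inf_le_right).trans hW)
  let ι : ↥(V ⊓ W) →L[ℝ] V := (Submodule.inclusion (inf_le_left : V ⊓ W ≤ V)).toContinuousLinearMap
  let z : Fin m → ↥(V ⊓ W) := fun j => ⟨WithLp.toLp 2 (Z.col j), hZV j, hZW j⟩
  -- The factorization is `Z = L* (L Z)`: the adjoint of an isometry is a left inverse of norm at
  -- most one.
  let A := ι ∘L L.toContinuousLinearMap.adjoint
  let B : Matrix (Fin k) (Fin m) ℝ := Matrix.of fun i j => L (z j) i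
  have hBcol : ∀ j, WithLp.toLp 2 (B.col j) = L (z j) := fun j => rfl
  refine ⟨A, B, ?_, ?_, ?_⟩
  · have hι : ‖ι‖ ≤ 1 := ι.opNorm_le_bound zero_le_one fun x => by rw [one_mul]; rfl
    have hL : ‖L.toContinuousLinearMap.adjoint‖ ≤ 1 := by
      rw [LinearIsometryEquiv.norm_map]
      exact L.norm_toContinuousLinearMap_le
    exact (ι.opNorm_comp_le _).trans (mul_le_one₀ hι (ContinuousLinearMap.opNorm_nonneg _) hL)
  · refine (sq_eq_sq₀ (norm_nonneg _) (norm_nonneg _)).1 ?_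
    rw [frobenius_norm_sq, frobenius_norm_sq]
    refine Finset.sum_congr rfl fun j _ => ?_
    rw [hBcol, L.norm_map]
    rfl
  · have hadj : ∀ w, L.toContinuousLinearMap.adjoint (L w) = w := fun w =>
      ext_inner_left ℝ fun v => by
        rw [ContinuousLinearMap.adjoint_inner_right]
        exact L.inner_map_map v w
    ext i j
    change (ι (L.toContinuousLinearMap.adjoint (WithLp.toLp 2 (B.col j))) :
      EuclideanSpace ℝ (Fin n)) i = Z i j
    rw [hBcol, hadj]
    rfl

/-- Products of net points serve as tests, with the operator norm on the left factor and the
Frobenius norm on the right one: `‖A B‖ ≤ ‖A‖ ‖B‖` keeps them in the unit ball. The factor spaces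
have dimensions at most `k D` and `k m`; `W` encodes the rank bound on `Z`. -/
theorem exists_test_matrices_of_subspace (V : Submodule ℝ (EuclideanSpace ℝ (Fin n)))
    {D : ℕ} (hV : Module.finrank ℝ V ≤ D) (m k : ℕ) :
    ∃ s : Finset (Matrix (Fin n) (Fin m) ℝ), s.card ≤ 5 ^ (k * D) * 5 ^ (k * m) ∧
      (∀ U ∈ s, ‖U‖ ≤ 1) ∧
      ∀ (E : Matrix (Fin n) (Fin m) ℝ) (M : ℝ), 0 ≤ M → (∀ U ∈ s, frobInner E U ≤ M) →
        ∀ (Z : Matrix (Fin n) (Fin m) ℝ) (W : Submodule ℝ (EuclideanSpace ℝ (Fin n))),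
          Module.finrank ℝ W ≤ k → (∀ j, WithLp.toLp 2 (Z.col j) ∈ W) →
          (∀ j, WithLp.toLp 2 (Z.col j) ∈ V) → frobInner E Z ≤ 4 * M * ‖Z‖ := by
  classical
  obtain ⟨s, hs, hscard⟩ := exists_isHalfNet (EuclideanSpace ℝ (Fin k) →L[ℝ] V)
  obtain ⟨t, ht, htcard⟩ := exists_isHalfNet (Matrix (Fin k) (Fin m) ℝ)
  refine ⟨Finset.image₂ applyColumns s t, ?_, ?_, ?_⟩
  · refine (Finset.card_image₂_le _ _ _).trans (Nat.mul_le_mul ?_ ?_)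
    · refine hscard.trans (Nat.pow_le_pow_right (by norm_num) ?_)
      rw [← (LinearMap.toContinuousLinearMap (𝕜 := ℝ)).finrank_eq, Module.finrank_linearMap,
        finrank_euclideanSpace_fin]
      gcongr
    · refine htcard.trans (Nat.pow_le_pow_right (by norm_num) ?_)
      simp [Module.finrank_matrix]
  · intro U hU
    obtain ⟨A, hA, B, hB, rfl⟩ := Finset.mem_image₂.1 hU
    exact (norm_applyColumns_le A B).trans (mul_le_one₀ (hs.1 A hA) (norm_nonneg _) (ht.1 B hB))
  · intro E M hM hE Z W hW hZW hZV
    obtain ⟨A, B, hA, hB, rfl⟩ := exists_applyColumns_eq Z W hW hZW hZV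
    have h := hs.bilinear_apply_le ht (factorPairing V k E) (M := M)
      (fun A hA B hB => hE _ (Finset.mem_image₂_of_mem hA hB)) A B
    calc frobInner E (applyColumns A B) ≤ 4 * M * ‖A‖ * ‖B‖ := h
      _ ≤ 4 * M * 1 * ‖B‖ := by gcongr
      _ = 4 * M * ‖applyColumns A B‖ := by rw [mul_one, hB]

end Factorization

/-- `v ↦ X v` with values in Euclidean space. -/
def euclideanMulVec {n p : ℕ} (X : Matrix (Fin n) (Fin p) ℝ) :
    (Fin p → ℝ) →ₗ[ℝ] EuclideanSpace ℝ (Fin n) :=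
  (WithLp.linearEquiv 2 ℝ (Fin n → ℝ)).symm.toLinearMap ∘ₗ X.mulVecLin

theorem finrank_range_euclideanMulVec {n p : ℕ} (X : Matrix (Fin n) (Fin p) ℝ) :
    Module.finrank ℝ (LinearMap.range (euclideanMulVec X)) = X.rank := by
  rw [euclideanMulVec, LinearMap.range_comp]
  exact LinearEquiv.finrank_map_eq _ _

theorem toLp_col_sub_mem {n p m : ℕ} (X : Matrix (Fin n) (Fin p) ℝ)
    {B B' : Matrix (Fin p) (Fin m) ℝ} {U U' : Submodule ℝ (Fin p → ℝ)} {j : Fin m}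
    (hU : B.col j ∈ U) (hU' : B'.col j ∈ U') :
    WithLp.toLp 2 ((X * B - X * B').col j) ∈
      U.map (euclideanMulVec X) ⊔ U'.map (euclideanMulVec X) := by
  have h : WithLp.toLp 2 ((X * B - X * B').col j)
      = euclideanMulVec X (B.col j) - euclideanMulVec X (B'.col j) := rfl
  rw [h]
  exact Submodule.sub_mem _ (Submodule.mem_sup_left (Submodule.mem_map_of_mem hU))
    (Submodule.mem_sup_right (Submodule.mem_map_of_mem hU'))

/-- Each image is also contained in the range of `X`; this is the source of `q ∧ rank X`. -/
theorem finrank_map_sup_map_le {n p a b : ℕ} (X : Matrix (Fin n) (Fin p) ℝ)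
    {U U' : Submodule ℝ (Fin p → ℝ)} (hU : Module.finrank ℝ U ≤ a)
    (hU' : Module.finrank ℝ U' ≤ b) :
    Module.finrank ℝ ↥(U.map (euclideanMulVec X) ⊔ U'.map (euclideanMulVec X)) ≤
      min a X.rank + min b X.rank := by
  have h : ∀ (U : Submodule ℝ (Fin p → ℝ)) (a : ℕ), Module.finrank ℝ U ≤ a →
      Module.finrank ℝ (U.map (euclideanMulVec X)) ≤ min a X.rank := fun U a hU =>
    le_min ((Submodule.finrank_map_le _ _).trans hU)
      ((Submodule.finrank_mono (LinearMap.map_le_range)).trans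
        (finrank_range_euclideanMulVec X).le)
  exact (Submodule.finrank_add_le_finrank_add_finrank _ _).trans
    (add_le_add (h U a hU) (h U' b hU'))

/-- Finitely many matrices in the unit ball control `⟨E, X B - X B*⟩ / ‖X B - X B*‖` uniformly over
the constraint set. -/
theorem exists_test_matrices {n p m q r : ℕ} (X : Matrix (Fin n) (Fin p) ℝ)
    {Bs : Matrix (Fin p) (Fin m) ℝ} (hBs : Bs ∈ crlClass p m q r) (hqp : q ≤ p)
    (hq : p ≠ 0 → q ≠ 0) :
    ∃ s : Finset (Matrix (Fin n) (Fin m) ℝ),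
      s.card ≤ q ^ (3 * (p - q)) * (5 ^ (2 * r * (2 * min q X.rank)) * 5 ^ (2 * r * m)) ∧
      (∀ U ∈ s, ‖U‖ ≤ 1) ∧
      ∀ (E : Matrix (Fin n) (Fin m) ℝ) (M : ℝ), 0 ≤ M → (∀ U ∈ s, frobInner E U ≤ M) →
        ∀ B ∈ crlClass p m q r,
          frobInner E (X * B - X * Bs) ≤ 4 * M * ‖X * B - X * Bs‖ := by
  classical
  obtain ⟨𝒰, hcard, hdim, hcov⟩ := exists_column_subspaces (m := m) hqp hq
  obtain ⟨Us, hUs, hBsU⟩ := hcov Bs hBs.2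
  -- The space `Us` of `Bs` is fixed once, so only the pattern of `B` is enumerated.
  let V : Submodule ℝ (Fin p → ℝ) → Submodule ℝ (EuclideanSpace ℝ (Fin n)) := fun U =>
    U.map (euclideanMulVec X) ⊔ Us.map (euclideanMulVec X)
  have hV : ∀ U : 𝒰, Module.finrank ℝ (V U) ≤ 2 * min q X.rank := fun U => by
    rw [two_mul]
    exact finrank_map_sup_map_le X (hdim U U.2) (hdim Us hUs)
  choose s hscard hs hsup using fun U : 𝒰 =>
    exists_test_matrices_of_subspace (V U) (hV U) m (2 * r)
  refine ⟨Finset.univ.biUnion s, ?_, ?_, ?_⟩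
  · refine (Finset.card_biUnion_le_card_mul _ _ _ fun U _ => hscard U).trans ?_
    gcongr
    simpa using hcard
  · intro U hU
    obtain ⟨U', -, hU⟩ := Finset.mem_biUnion.1 hU
    exact hs U' U hU
  · intro E M hM hE B hB
    obtain ⟨U, hU, hBU⟩ := hcov B hB.2
    refine hsup ⟨U, hU⟩ E M hM
      (fun T hT => hE T (Finset.mem_biUnion.2 ⟨_, Finset.mem_univ _, hT⟩)) _
      ((LinearMap.range B.mulVecLin).map (euclideanMulVec X) ⊔
        (LinearMap.range Bs.mulVecLin).map (euclideanMulVec X)) ?_ ?_ ?_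
    · refine (finrank_map_sup_map_le X hB.1 hBs.1).trans ?_
      rw [two_mul]
      exact add_le_add (min_le_left _ _) (min_le_left _ _)
    · exact fun j => toLp_col_sub_mem X ⟨Pi.single j 1, by simp⟩ ⟨Pi.single j 1, by simp⟩
    · exact fun j => toLp_col_sub_mem X (hBU j) (hBsU j)

end

/-! ### Sub-Gaussian maxima -/

theorem aemeasurable_frobInner {Ω : Type*} [MeasurableSpace Ω] {μ : Measure Ω} {n m : ℕ}
    {E : Ω → Matrix (Fin n) (Fin m) ℝ} (hE : ∀ i j, AEMeasurable (fun ω => E ω i j) μ)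
    (A : Matrix (Fin n) (Fin m) ℝ) : AEMeasurable (fun ω => frobInner (E ω) A) μ := by
  unfold frobInner
  exact Finset.aemeasurable_fun_sum _ fun i _ => Finset.aemeasurable_fun_sum _ fun j _ =>
    (hE i j).mul_const _

/-- The strict inequality `σ < t` avoids asking whether the infimum in `psi2Norm` is attained, and
covers `σ = 0`. -/
theorem IsCenteredSubGaussian.lintegral_exp_sq_le {Ω : Type*} [MeasurableSpace Ω] {μ : Measure Ω}
    {n m : ℕ} {E : Ω → Matrix (Fin n) (Fin m) ℝ} {σ t : ℝ} (hE : IsCenteredSubGaussian μ E σ)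
    (hσ : 0 ≤ σ) (hσt : σ < t) {A : Matrix (Fin n) (Fin m) ℝ} (hA : ‖A‖ ≤ 1) :
    ∫⁻ ω, ENNReal.ofReal (Real.exp ((frobInner (E ω) A / t) ^ 2)) ∂μ ≤ 2 := by
  have hlt : psi2Norm μ (fun ω => frobInner (E ω) A) < ENNReal.ofReal t :=
    (hE.psi2_le A).trans_lt ((ENNReal.ofReal_lt_ofReal_iff (hσ.trans_lt hσt)).2
      ((mul_le_of_le_one_right hσ hA).trans_lt hσt))
  simp only [psi2Norm, iInf_lt_iff] at hlt
  obtain ⟨u, hu, hint, hut⟩ := hlt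
  refine (lintegral_mono fun ω => ?_).trans hint
  have hut' : u ≤ t := (ENNReal.ofReal_lt_ofReal_iff_of_nonneg hu.le).1 hut |>.le
  refine ENNReal.ofReal_le_ofReal (Real.exp_le_exp.2 ?_)
  rw [div_pow, div_pow]
  gcongr

/-- The maximum of the squares of finitely many sub-Gaussian variables has an integrable majorant
whose mean is of the order of the logarithm of their number. -/
theorem IsCenteredSubGaussian.exists_sq_majorant {Ω : Type*} [MeasurableSpace Ω] {μ : Measure Ω}
    [IsProbabilityMeasure μ] {n m : ℕ} {E : Ω → Matrix (Fin n) (Fin m) ℝ} {σ t : ℝ}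
    (hE : IsCenteredSubGaussian μ E σ) (hσ : 0 ≤ σ) (hσt : σ < t)
    {s : Finset (Matrix (Fin n) (Fin m) ℝ)} (hs : ∀ U ∈ s, ‖U‖ ≤ 1) {N : ℕ} (hN : 0 < N)
    (hsN : s.card ≤ N) :
    ∃ g : Ω → ℝ, Integrable g μ ∧ (∀ ω, 0 ≤ g ω) ∧
      (∀ ω, ∀ U ∈ s, frobInner (E ω) U ^ 2 ≤ g ω) ∧
      ∫ ω, g ω ∂μ ≤ t ^ 2 * (Real.log (2 * N) + 1) := by
  have ht : 0 < t := hσ.trans_lt hσt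
  have hN' : (1 : ℝ) ≤ N := by exact_mod_cast hN
  have hlog : 0 ≤ Real.log (2 * N) := Real.log_nonneg (by linarith)
  let e : Matrix (Fin n) (Fin m) ℝ → Ω → ℝ := fun U ω => Real.exp ((frobInner (E ω) U / t) ^ 2)
  have hmeas : ∀ U, AEStronglyMeasurable (e U) μ := fun U =>
    (Real.measurable_exp.comp_aemeasurable
      (((aemeasurable_frobInner hE.aemeasurable U).div_const t).pow_const 2)).aestronglyMeasurable
  have hpos : ∀ U, 0 ≤ᵐ[μ] e U := fun U => Filter.Eventually.of_forall fun ω => (Real.exp_pos _).le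
  have hint : ∀ U ∈ s, Integrable (e U) μ := fun U hU =>
    ⟨hmeas U, by
      rw [hasFiniteIntegral_iff_ofReal (hpos U)]
      exact (hE.lintegral_exp_sq_le hσ hσt (hs U hU)).trans_lt (by simp)⟩
  have hmean : ∀ U ∈ s, ∫ ω, e U ω ∂μ ≤ 2 := fun U hU => by
    rw [integral_eq_lintegral_of_nonneg_ae (hpos U) (hmeas U)]
    exact ENNReal.toReal_le_of_le_ofReal (by norm_num)
      (by simpa using hE.lintegral_exp_sq_le hσ hσt (hs U hU))
  have hsum : Integrable (fun ω => (∑ U ∈ s, e U ω) / (2 * N)) μ :=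
    (integrable_finsetSum s hint).div_const _
  -- The tangent-line bound `x ≤ log (2N) + exp x / (2N)`, with the exponential summed over `s`,
  -- majorizes every square at once; the sum has mean at most `2N`.
  refine ⟨fun ω => t ^ 2 * (Real.log (2 * N) + (∑ U ∈ s, e U ω) / (2 * N)),
    ((integrable_const _).add hsum).const_mul _, fun ω => ?_, fun ω U hU => ?_, ?_⟩
  · have : 0 ≤ ∑ U ∈ s, e U ω := Finset.sum_nonneg fun U _ => (Real.exp_pos _).le
    positivity
  · have h₁ : (frobInner (E ω) U / t) ^ 2 - Real.log (2 * N) + 1 ≤ e U ω / (2 * N) := by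
      refine (Real.add_one_le_exp _).trans_eq ?_
      rw [Real.exp_sub, Real.exp_log (by positivity)]
    have h₂ : e U ω ≤ ∑ U ∈ s, e U ω :=
      Finset.single_le_sum (f := fun U => e U ω) (fun U _ => (Real.exp_pos _).le) hU
    have h₃ : e U ω / (2 * N) ≤ (∑ U ∈ s, e U ω) / (2 * N) := by gcongr
    calc frobInner (E ω) U ^ 2 = t ^ 2 * (frobInner (E ω) U / t) ^ 2 := by
          field_simp
      _ ≤ _ := mul_le_mul_of_nonneg_left (by linarith) (sq_nonneg t)
  · rw [integral_const_mul, integral_add (integrable_const _) hsum, integral_div,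
      integral_finsetSum s hint]
    simp only [integral_const, probReal_univ, one_smul]
    gcongr
    rw [div_le_one (by positivity)]
    calc ∑ U ∈ s, ∫ ω, e U ω ∂μ ≤ ∑ U ∈ s, (2 : ℝ) := Finset.sum_le_sum hmean
      _ = 2 * s.card := by rw [Finset.sum_const, nsmul_eq_mul, mul_comm]
      _ ≤ 2 * N := by gcongr

/-! ### The risk bound -/

theorem Po_eq {n p : ℕ} (m : ℕ) (X : Matrix (Fin n) (Fin p) ℝ) {q : ℕ} (r : ℕ) (hqp : q ≤ p) :
    Po m X q r = ((min q X.rank : ℕ) : ℝ) * r + m * r + (p - q : ℕ) * Real.log q := by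
  rw [Po, Nat.cast_sub hqp]
  ring

theorem Po_nonneg {n p : ℕ} (m : ℕ) (X : Matrix (Fin n) (Fin p) ℝ) {q : ℕ} (r : ℕ)
    (hqp : q ≤ p) : 0 ≤ Po m X q r := by
  rw [Po_eq m X r hqp]
  have := Real.log_natCast_nonneg q
  positivity

theorem log_card_bound_le {n p : ℕ} (m : ℕ) (X : Matrix (Fin n) (Fin p) ℝ) {q : ℕ} (r : ℕ)
    (hqp : q ≤ p) (hq : p ≠ 0 → q ≠ 0) :
    Real.log (2 * (q ^ (3 * (p - q)) *
      (5 ^ (2 * r * (2 * min q X.rank)) * 5 ^ (2 * r * m)) : ℕ)) + 1 ≤ 16 * (Po m X q r + 1) := by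
  have hq0 : ((q : ℝ) ^ (3 * (p - q))) ≠ 0 := by
    rcases Nat.eq_zero_or_pos p with rfl | hp
    · simp
    · exact pow_ne_zero _ (Nat.cast_ne_zero.2 (hq hp.ne'))
  have h2 : Real.log 2 ≤ 1 := by
    linarith [Real.log_le_sub_one_of_pos (show (0 : ℝ) < 2 by norm_num)]
  have h5 : Real.log 5 ≤ 4 := by
    linarith [Real.log_le_sub_one_of_pos (show (0 : ℝ) < 5 by norm_num)]
  have hq1 : 0 ≤ ((p - q : ℕ) : ℝ) * Real.log q :=
    mul_nonneg (Nat.cast_nonneg _) (Real.log_natCast_nonneg q)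
  rw [Po_eq m X r hqp]
  simp only [Nat.cast_mul, Nat.cast_pow, Nat.cast_ofNat]
  rw [Real.log_mul (by norm_num) (by positivity), Real.log_mul hq0 (by positivity),
    Real.log_mul (by positivity) (by positivity), Real.log_pow, Real.log_pow, Real.log_pow]
  push_cast [-Nat.cast_sub, -Nat.cast_min]
  have ha : 0 ≤ (r : ℝ) * ((min q X.rank : ℕ) : ℝ) := by positivity
  have hb : 0 ≤ (r : ℝ) * (m : ℝ) := by positivity
  -- With `log 5 ≤ 4` the coefficients of the three terms of `Po` are at most `16`, `8` and `3`, and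
  -- the constant is at most `2`.
  nlinarith [mul_le_mul_of_nonneg_left h5 ha, mul_le_mul_of_nonneg_left h5 hb]

theorem aemeasurable_norm_sq {Ω : Type*} [MeasurableSpace Ω] {μ : Measure Ω} {n m : ℕ}
    {A : Ω → Matrix (Fin n) (Fin m) ℝ} (hA : ∀ i j, AEMeasurable (fun ω => A ω i j) μ) :
    AEMeasurable (fun ω => ‖A ω‖ ^ 2) μ := by
  simp only [frobenius_norm_sq, EuclideanSpace.norm_sq_eq]
  exact Finset.aemeasurable_fun_sum _ fun j _ => Finset.aemeasurable_fun_sum _ fun i _ =>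
    (hA i j).norm.pow_const 2

/-- Solving the quadratic inequality `δ / 2 s² ≤ 4 √g s + c` for `s²`. -/
theorem sq_le_of_basic_inequality {s g c δ : ℝ} (hδ : 0 < δ) (hg : 0 ≤ g)
    (h : δ / 2 * s ^ 2 ≤ 4 * √g * s + c) : s ^ 2 ≤ 64 / δ ^ 2 * g + 4 / δ * c := by
  have hsq : √g ^ 2 = g := Real.sq_sqrt hg
  have h₁ : 0 ≤ (δ * s - 8 * √g) ^ 2 := sq_nonneg _
  have h₂ : δ ^ 2 * s ^ 2 ≤ 64 * g + 4 * δ * c := by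
    have h₃ := mul_le_mul_of_nonneg_left h (show 0 ≤ 4 * δ by positivity)
    nlinarith
  have h₄ : s ^ 2 ≤ (64 * g + 4 * δ * c) / δ ^ 2 := by
    rw [le_div_iff₀ (by positivity)]
    linarith
  refine h₄.trans_eq ?_
  field_simp

theorem theorem2 :
    ∃ C : ℝ, 0 < C ∧
      ∀ (n p m q r : ℕ) (X : Matrix (Fin n) (Fin p) ℝ) (Bstar : Matrix (Fin p) (Fin m) ℝ)
        (Ω : Type*) [MeasurableSpace Ω] (μ : Measure Ω) [IsProbabilityMeasure μ]
        (l₀ : Matrix (Fin n) (Fin m) ℝ → Matrix (Fin n) (Fin m) ℝ → ℝ)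
        (Y : Ω → Matrix (Fin n) (Fin m) ℝ) (Bhat : Ω → Matrix (Fin p) (Fin m) ℝ)
        (σ ρ δ K : ℝ),
        Bstar.rank ≤ r → numDistinctRows Bstar ≤ q → q ≤ p →
        (∀ y, Differentiable ℝ fun η => l₀ η y) →
        0 ≤ σ → IsCenteredSubGaussian μ (effectiveNoise l₀ X Bstar Y) σ →
        0 < ρ → 0 < δ → 0 ≤ K →
        (∀ᵐ ω ∂μ, RestrictedRegularity (fun η => l₀ η (Y ω)) X ρ δ K σ q r) →
        (∀ i j, AEMeasurable (fun ω => Bhat ω i j) μ) →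
        (∀ᵐ ω ∂μ, IsCRLFixedPoint (fun η => l₀ η (Y ω)) X ρ q r (Bhat ω)) →
        Integrable (fun ω => ‖X * Bhat ω - X * Bstar‖ ^ 2) μ ∧
          ∫ ω, ‖X * Bhat ω - X * Bstar‖ ^ 2 ∂μ ≤
            C * (max (K * δ) 1 / δ ^ 2) *
              (σ ^ 2 * ((min q X.rank : ℕ) + (m : ℝ)) * r
                + σ ^ 2 * ((p : ℝ) - q) * Real.log q + σ ^ 2) := by
  refine ⟨1028, by norm_num, ?_⟩
  intro n p m q r X Bstar Ω _ μ _ l₀ Y Bhat σ ρ δ K hrank hrows hqp _ hσ hE _ hδ hK hreg hmeas hfix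
  have hBstar : Bstar ∈ crlClass p m q r := ⟨hrank, hrows⟩
  -- A matrix with at least one row has a distinct row; this keeps the count `q ^ (3 * (p - q))`
  -- positive.
  have hq : p ≠ 0 → q ≠ 0 := by
    rintro hp rfl
    have h0 : (Set.range fun i : Fin p => Bstar i) = ∅ :=
      (Set.ncard_eq_zero (Set.finite_range _)).1 (Nat.le_zero.1 hrows)
    exact (Set.range_eq_empty_iff.1 h0).false ⟨0, Nat.pos_of_ne_zero hp⟩
  obtain ⟨s, hcard, hs, hsup⟩ := exists_test_matrices X hBstar hqp hq
  set N : ℕ := q ^ (3 * (p - q)) * (5 ^ (2 * r * (2 * min q X.rank)) * 5 ^ (2 * r * m)) with hNdef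
  have hN : 0 < N := by
    have : 0 < q ^ (3 * (p - q)) := by
      rcases Nat.eq_zero_or_pos p with rfl | hp
      · simp
      · exact pow_pos (Nat.pos_of_ne_zero (hq hp.ne')) _
    positivity
  have hlog := log_card_bound_le m X r hqp hq
  rw [← hNdef] at hlog
  have hPo := Po_nonneg m X r hqp
  have hmeas_risk : AEMeasurable (fun ω => ‖X * Bhat ω - X * Bstar‖ ^ 2) μ := by
    refine aemeasurable_norm_sq fun i j => ?_
    simp only [Matrix.sub_apply, Matrix.mul_apply]
    exact (Finset.aemeasurable_fun_sum _ fun l _ => (hmeas l j).const_mul _).sub_const _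
  have hbound : ∀ t, σ < t → Integrable (fun ω => ‖X * Bhat ω - X * Bstar‖ ^ 2) μ ∧
      ∫ ω, ‖X * Bhat ω - X * Bstar‖ ^ 2 ∂μ ≤
        64 / δ ^ 2 * (t ^ 2 * (16 * (Po m X q r + 1))) + 4 / δ * (K * σ ^ 2 * Po m X q r) := by
    intro t ht
    obtain ⟨g, hg_int, hg_nonneg, hg, hg_mean⟩ := hE.exists_sq_majorant hσ ht hs hN hcard
    have hle : ∀ᵐ ω ∂μ, ‖X * Bhat ω - X * Bstar‖ ^ 2 ≤
        64 / δ ^ 2 * g ω + 4 / δ * (K * σ ^ 2 * Po m X q r) := by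
      filter_upwards [hreg, hfix] with ω hreg hfix
      refine sq_le_of_basic_inequality hδ (hg_nonneg ω)
        ((hfix.basic_inequality hreg hBstar).trans ?_)
      gcongr
      exact hsup _ _ (Real.sqrt_nonneg _) (fun U hU => Real.le_sqrt_of_sq_le (hg ω U hU)) _ hfix.1
    have hdom : Integrable
        (fun ω => 64 / δ ^ 2 * g ω + 4 / δ * (K * σ ^ 2 * Po m X q r)) μ :=
      (hg_int.const_mul _).add (integrable_const _)
    have hint : Integrable (fun ω => ‖X * Bhat ω - X * Bstar‖ ^ 2) μ := by
      refine hdom.mono' hmeas_risk.aestronglyMeasurable ?_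
      filter_upwards [hle] with ω hω
      rwa [Real.norm_of_nonneg (by positivity)]
    refine ⟨hint, (integral_mono_ae hint hdom hle).trans ?_⟩
    rw [integral_add (hg_int.const_mul _) (integrable_const _), integral_const_mul]
    simp only [integral_const, probReal_univ, one_smul]
    gcongr
    exact hg_mean.trans (by gcongr)
  refine ⟨(hbound (σ + 1) (by linarith)).1, ?_⟩
  -- Let `t` decrease to `σ` in the bounds just obtained.
  have hlim : ∫ ω, ‖X * Bhat ω - X * Bstar‖ ^ 2 ∂μ ≤
      64 / δ ^ 2 * (σ ^ 2 * (16 * (Po m X q r + 1))) + 4 / δ * (K * σ ^ 2 * Po m X q r) := by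
    have hcont : Continuous fun t : ℝ =>
        64 / δ ^ 2 * (t ^ 2 * (16 * (Po m X q r + 1))) + 4 / δ * (K * σ ^ 2 * Po m X q r) := by
      fun_prop
    refine ge_of_tendsto (x := nhdsWithin σ (Set.Ioi σ))
      ((hcont.tendsto σ).mono_left nhdsWithin_le_nhds) ?_
    filter_upwards [self_mem_nhdsWithin] with t ht
    exact (hbound t ht).2
  have hfactor : σ ^ 2 * ((min q X.rank : ℕ) + (m : ℝ)) * r
      + σ ^ 2 * ((p : ℝ) - q) * Real.log q + σ ^ 2 = σ ^ 2 * (Po m X q r + 1) := by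
    unfold Po; ring
  rw [hfactor]
  -- The constant is `1028 = 64 * 16 + 4`: noise term plus regularity remainder.
  calc _ ≤ _ := hlim
    _ = 1024 * (1 / δ ^ 2) * (σ ^ 2 * (Po m X q r + 1))
          + 4 * (K * δ / δ ^ 2) * (σ ^ 2 * Po m X q r) := by
        field_simp
        ring
    _ ≤ 1024 * (max (K * δ) 1 / δ ^ 2) * (σ ^ 2 * (Po m X q r + 1))
          + 4 * (max (K * δ) 1 / δ ^ 2) * (σ ^ 2 * (Po m X q r + 1)) := by
        gcongr
        · exact le_max_right _ _
        · exact le_max_left _ _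
        · linarith
    _ = 1028 * (max (K * δ) 1 / δ ^ 2) * (σ ^ 2 * (Po m X q r + 1)) := by ring
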